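/- Let $G$ be a totally disconnected, locally compact group. For $x\in G$ define the scale $$s_G(x)=\min\{[xVx^{-1}:xVx^{-1}\cap V] : V\le G \text{ a compact open subgroup}\}$$ and the contraction subgroup $$\mathsf{con}(x)=\{g\in G : x^n g x^{-n}\to e \text{ as } n\to\infty\}.$$ A closed subgroup $H$ of $G$ has finite co-volume if the space $G/H$ of left cosets carries a nonzero finite Radon (i.e. regular Borel) measure that is invariant under left translation by $G$. **Theorem.** Let $H$ be a closed subgroup of $G$ of finite co-volume. Then for every $x\in G$ there are an integer $n\ge 1$ and an element $h\in H$ such that $$s_G(x)^n=s_G(h),$$ and, for this same $h$, the subgroup $\mathsf{con}(h)$ is conjugate in $G$ to $\mathsf{con}(x)$, that is, $\mathsf{con}(h)=g\,\mathsf{con}(x)\,g^{-1}$ for some $g\in G$. -/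

import Mathlib

open Filter Topology MeasureTheory

/-- The conjugate subgroup `x V x⁻¹`. -/
def conjSubgroup {G : Type*} [Group G] (x : G) (V : Subgroup G) : Subgroup G :=
  V.map (MulAut.conj x).toMonoidHom

/-- A closed subgroup `H` of a locally compact group `G` has finite co-volume if the space `G ⧸ H`
of left cosets carries a nonzero finite regular Borel (that is, Radon) measure which is invariant
under left translation by `G`. -/
def HasFiniteCovolume {G : Type*} [Group G] [TopologicalSpace G] (H : Subgroup G) : Prop :=
  letI : MeasurableSpace (G ⧸ H) := borel (G ⧸ H)
  ∃ μ : Measure (G ⧸ H),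
    μ ≠ 0 ∧ IsFiniteMeasure μ ∧ μ.Regular ∧ SMulInvariantMeasure G (G ⧸ H) μ

/-- The scale `s_G(x)`: the minimum of the indices `[xVx⁻¹ : xVx⁻¹ ∩ V]` over all compact open
subgroups `V` of `G`. Here `V.relIndex K` is the index `[K : K ∩ V]`. -/
noncomputable def scale {G : Type*} [Group G] [TopologicalSpace G] (x : G) : ℕ :=
  sInf {k : ℕ | ∃ V : Subgroup G, IsCompact (V : Set G) ∧ IsOpen (V : Set G) ∧
    k = V.relIndex (conjSubgroup x V)}

/-- The contraction subgroup `con(x) = {g | xⁿ g x⁻ⁿ → e as n → ∞}`. -/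
def contractionSubgroup {G : Type*} [Group G] [TopologicalSpace G] [IsTopologicalGroup G]
    (x : G) : Subgroup G where
  carrier := {g : G | Tendsto (fun n : ℕ => x ^ n * g * (x ^ n)⁻¹) atTop (𝓝 1)}
  one_mem' := by
    change Tendsto (fun n : ℕ => x ^ n * 1 * (x ^ n)⁻¹) atTop (𝓝 1)
    simpa using tendsto_const_nhds
  mul_mem' := by
    intro a b ha hb
    have h := Tendsto.mul (show Tendsto (fun n : ℕ => x ^ n * a * (x ^ n)⁻¹) atTop (𝓝 1) from ha)
      (show Tendsto (fun n : ℕ => x ^ n * b * (x ^ n)⁻¹) atTop (𝓝 1) from hb)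
    simpa [mul_assoc] using h
  inv_mem' := by
    intro a ha
    have h := Tendsto.inv (show Tendsto (fun n : ℕ => x ^ n * a * (x ^ n)⁻¹) atTop (𝓝 1) from ha)
    simpa [mul_assoc] using h

/-!
The argument rests on Willis' tidy subgroups. For a compact open subgroup `V` put
`V₊ = ⋂ n ≥ 0, xⁿ V x⁻ⁿ` and `V₋ = ⋂ n ≥ 0, x⁻ⁿ V xⁿ`. Call `V` *tidy above* if `V = V₋ V₊`, and
call *homoclinic* the elements `g` with `xⁿ g x⁻ⁿ ∈ V` for all but finitely many integers `n`.

*Tidy subgroups exist* (`exists_tidy`). By compactness, `⋂ 0 ≤ k ≤ N, xᵏ V x⁻ᵏ` is tidy above for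
large `N` (`exists_tidyAbove`). If `V` is tidy above, its homoclinic elements form a relatively
compact group; let `L` be the closure. A compact open subgroup `W` with `L ≤ W ⊆ L V'`, where `V'`
is small, has no homoclinic elements outside `L`
(`TidyAbove.homoclinic_le_topologicalClosure`). Making `W` tidy above gives a subgroup which is tidy
above and contains its homoclinic elements.

*Tidy subgroups realize the scale.* For such a `V` one has `xⁿ V₊ x⁻ⁿ ∩ V = V₊`, so the index
`[xⁿVx⁻ⁿ : xⁿVx⁻ⁿ ∩ V] = [xⁿV₊x⁻ⁿ : V₊]` is the `n`-th power of its value at `n = 1`. Replacing `V`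
by another compact open subgroup changes this index by a factor bounded in `n`, hence `V` attains
the minimum that defines the scale (`scale_eq_of_relIndex_pow`). As `(x v)ᵏ ∈ V xᵏ V` for `v ∈ V`,
the same holds for all elements of `xⁿ V`, and they have scale `s(x)ⁿ`
(`TidyAbove.scale_pow_mul`).

*Contraction subgroups.* For `v ∈ V` there is `t ∈ V` with `(x v)ᵏ t ∈ V xᵏ` for all `k ≥ 0`. Since
conjugation by elements of the compact group `V` does not affect convergence to the identity,
`con(x v) = t con(x) t⁻¹` (`TidyAbove.exists_contractionSubgroup_mul_eq`).

*Recurrence.* Poincaré recurrence on `G ⧸ H`, for the translation by `x` and the image of `V`,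
yields `n ≥ 1` and `v, w ∈ V` with `w⁻¹ xⁿ v ∈ H` (`HasFiniteCovolume.exists_pow_mul_mem`). This
element of `H` is conjugate to `xⁿ v w⁻¹ ∈ xⁿ V`, to which the previous points apply.
-/

open scoped Pointwise

/-! ### Conjugation by powers and the subgroups it cuts out -/

section Orbit

variable {G : Type*} [Group G]

/-- Conjugation by `xⁿ` for an integer `n`, as a homomorphism `g ↦ xⁿ g x⁻ⁿ`. -/
def conjPow (x : G) (n : ℤ) : G →* G := (MulAut.conj (x ^ n)).toMonoidHom

lemma conjPow_apply (x : G) (n : ℤ) (g : G) : conjPow x n g = x ^ n * g * (x ^ n)⁻¹ := rfl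

@[simp] lemma conjPow_zero (x g : G) : conjPow x 0 g = g := by simp [conjPow_apply]

lemma conjPow_conjPow (x : G) (m n : ℤ) (g : G) :
    conjPow x m (conjPow x n g) = conjPow x (m + n) g := by
  simp only [conjPow_apply]; group

lemma conjPow_inv_base (x : G) (n : ℤ) (g : G) : conjPow x⁻¹ n g = conjPow x (-n) g := by
  simp [conjPow_apply]

lemma continuous_conjPow [TopologicalSpace G] [IsTopologicalGroup G] (x : G) (n : ℤ) :
    Continuous (conjPow x n) := by
  change Continuous fun g => x ^ n * g * (x ^ n)⁻¹
  fun_prop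

/-- The elements `g` such that `xⁿ g x⁻ⁿ ∈ V` for `l`-almost all integers `n`. For a principal
filter `𝓟 S` this is `⋂ n ∈ S, x⁻ⁿ V xⁿ`. -/
def orbitSubgroup (x : G) (V : Subgroup G) (l : Filter ℤ) : Subgroup G where
  carrier := {g | ∀ᶠ n in l, conjPow x n g ∈ V}
  one_mem' := by simp
  mul_mem' := by
    intro a b ha hb
    filter_upwards [ha, hb] with n h₁ h₂
    rw [map_mul]
    exact mul_mem h₁ h₂
  inv_mem' := by
    intro a ha
    filter_upwards [ha] with n h
    rw [map_inv]
    exact inv_mem h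

/-- Willis' subgroup `V₊ = ⋂ n ≥ 0, xⁿ V x⁻ⁿ`. -/
noncomputable abbrev plusPart (x : G) (V : Subgroup G) : Subgroup G :=
  orbitSubgroup x V (𝓟 (Set.Iic 0))

/-- Willis' subgroup `V₋ = ⋂ n ≥ 0, x⁻ⁿ V xⁿ`. -/
noncomputable abbrev minusPart (x : G) (V : Subgroup G) : Subgroup G :=
  orbitSubgroup x V (𝓟 (Set.Ici 0))

/-- The elements `g` such that `xⁿ g x⁻ⁿ ∈ V` for all but finitely many integers `n`. -/
noncomputable abbrev homoclinic (x : G) (V : Subgroup G) : Subgroup G :=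
  orbitSubgroup x V (atBot ⊔ atTop)

/-- `V` is tidy above for `x` if `V = V₋ V₊`. -/
def TidyAbove (x : G) (V : Subgroup G) : Prop :=
  ∀ v ∈ V, ∃ a ∈ minusPart x V, ∃ b ∈ plusPart x V, v = a * b

variable {x : G} {V : Subgroup G}

lemma mem_orbitSubgroup_principal {S : Set ℤ} {g : G} :
    g ∈ orbitSubgroup x V (𝓟 S) ↔ ∀ n ∈ S, conjPow x n g ∈ V := eventually_principal

lemma mem_plusPart {g : G} : g ∈ plusPart x V ↔ ∀ n ≤ 0, conjPow x n g ∈ V := eventually_principal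

lemma mem_minusPart {g : G} : g ∈ minusPart x V ↔ ∀ n, 0 ≤ n → conjPow x n g ∈ V :=
  eventually_principal

lemma mem_homoclinic {g : G} : g ∈ homoclinic x V ↔
    g ∈ orbitSubgroup x V atBot ∧ g ∈ orbitSubgroup x V atTop := eventually_sup

lemma orbitSubgroup_mono {V' : Subgroup G} (h : V ≤ V') (l : Filter ℤ) :
    orbitSubgroup x V l ≤ orbitSubgroup x V' l := fun _ hg => hg.mono fun _ hn => h hn

lemma plusPart_le : plusPart x V ≤ V := fun g hg => by
  simpa using mem_plusPart.1 hg 0 le_rfl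

lemma minusPart_le : minusPart x V ≤ V := fun g hg => by
  simpa using mem_minusPart.1 hg 0 le_rfl

lemma plusPart_le_atBot : plusPart x V ≤ orbitSubgroup x V atBot := fun _ hg =>
  (eventually_le_atBot 0).mono (mem_plusPart.1 hg)

lemma minusPart_le_atTop : minusPart x V ≤ orbitSubgroup x V atTop := fun _ hg =>
  (eventually_ge_atTop 0).mono (mem_minusPart.1 hg)

lemma conjPow_mem_plusPart {g : G} (hg : g ∈ plusPart x V) {k : ℤ} (hk : k ≤ 0) :
    conjPow x k g ∈ plusPart x V := mem_plusPart.2 fun n hn => by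
  rw [conjPow_conjPow]
  exact mem_plusPart.1 hg _ (by omega)

lemma conjPow_mem_minusPart {g : G} (hg : g ∈ minusPart x V) {k : ℤ} (hk : 0 ≤ k) :
    conjPow x k g ∈ minusPart x V := mem_minusPart.2 fun n hn => by
  rw [conjPow_conjPow]
  exact mem_minusPart.1 hg _ (by omega)

lemma conjPow_mem_atBot {g : G} (hg : g ∈ orbitSubgroup x V atBot) (k : ℤ) :
    conjPow x k g ∈ orbitSubgroup x V atBot := by
  obtain ⟨N, hN⟩ := eventually_atBot.1 hg
  refine eventually_atBot.2 ⟨N - k, fun n hn => ?_⟩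
  rw [conjPow_conjPow]
  exact hN _ (by omega)

lemma conjPow_mem_atTop {g : G} (hg : g ∈ orbitSubgroup x V atTop) (k : ℤ) :
    conjPow x k g ∈ orbitSubgroup x V atTop := by
  obtain ⟨N, hN⟩ := eventually_atTop.1 hg
  refine eventually_atTop.2 ⟨N - k, fun n hn => ?_⟩
  rw [conjPow_conjPow]
  exact hN _ (by omega)

lemma conjPow_mem_homoclinic {g : G} (hg : g ∈ homoclinic x V) (k : ℤ) :
    conjPow x k g ∈ homoclinic x V :=
  mem_homoclinic.2 ⟨conjPow_mem_atBot (mem_homoclinic.1 hg).1 k,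
    conjPow_mem_atTop (mem_homoclinic.1 hg).2 k⟩

lemma plusPart_inv_base : plusPart x⁻¹ V = minusPart x V := by
  ext g
  rw [mem_plusPart, mem_minusPart]
  refine ⟨fun h n hn => ?_, fun h n hn => ?_⟩
  · simpa [conjPow_inv_base] using h (-n) (by omega)
  · rw [conjPow_inv_base]
    exact h _ (by omega)

lemma minusPart_inv_base : minusPart x⁻¹ V = plusPart x V := by
  rw [← plusPart_inv_base, inv_inv]

lemma TidyAbove.exists_plus_mul_minus (hV : TidyAbove x V) {v : G} (hv : v ∈ V) :
    ∃ b ∈ plusPart x V, ∃ a ∈ minusPart x V, v = b * a := by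
  obtain ⟨a, ha, b, hb, h⟩ := hV v⁻¹ (inv_mem hv)
  exact ⟨b⁻¹, inv_mem hb, a⁻¹, inv_mem ha, by rw [← mul_inv_rev, ← h, inv_inv]⟩

section Topology

variable [TopologicalSpace G] [IsTopologicalGroup G]

lemma isClosed_orbitSubgroup (hV : IsClosed (V : Set G)) (S : Set ℤ) :
    IsClosed (orbitSubgroup x V (𝓟 S) : Set G) := by
  have : (orbitSubgroup x V (𝓟 S) : Set G) = ⋂ n ∈ S, conjPow x n ⁻¹' V := by
    ext g; simp [mem_orbitSubgroup_principal]
  rw [this]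
  exact isClosed_biInter fun n _ => hV.preimage (continuous_conjPow x n)

lemma isOpen_orbitSubgroup (hV : IsOpen (V : Set G)) {S : Set ℤ} (hS : S.Finite) :
    IsOpen (orbitSubgroup x V (𝓟 S) : Set G) := by
  have : (orbitSubgroup x V (𝓟 S) : Set G) = ⋂ n ∈ S, conjPow x n ⁻¹' V := by
    ext g; simp [mem_orbitSubgroup_principal]
  rw [this]
  exact hS.isOpen_biInter fun n _ => hV.preimage (continuous_conjPow x n)

lemma isCompact_orbitSubgroup (hVc : IsCompact (V : Set G)) (hVo : IsOpen (V : Set G))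
    {S : Set ℤ} (hS : (0 : ℤ) ∈ S) : IsCompact (orbitSubgroup x V (𝓟 S) : Set G) :=
  hVc.of_isClosed_subset (isClosed_orbitSubgroup (V.isClosed_of_isOpen hVo) S) fun g hg => by
    simpa using mem_orbitSubgroup_principal.1 hg 0 hS

/-! ### Tidiness above -/

/-- For large `N` the set `⋂ 0 ≤ k ≤ N, xᵏ W x⁻ᵏ` is contained in `V₊ · x⁻¹ W x`, since the latter
is an open set that contains the intersection `V₊` of these decreasing compact sets. -/
lemma exists_orbitSubgroup_le_plusPart_mul [T2Space G] (x : G) {W : Subgroup G}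
    (hWc : IsCompact (W : Set G)) (hWo : IsOpen (W : Set G)) :
    ∃ N : ℕ, ∀ u ∈ orbitSubgroup x W (𝓟 (Set.Icc (-N : ℤ) 0)),
      ∃ p ∈ plusPart x W, ∃ r, conjPow x 1 r ∈ W ∧ u = p * r := by
  have hO : IsOpen ((plusPart x W : Set G) * (conjPow x 1 ⁻¹' (W : Set G))) :=
    (hWo.preimage (continuous_conjPow x 1)).mul_left
  obtain ⟨N, hN⟩ := exists_subset_nhds_of_isCompact
    (V := fun N : ℕ => (orbitSubgroup x W (𝓟 (Set.Icc (-N : ℤ) 0)) : Set G))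
    (U := (plusPart x W : Set G) * (conjPow x 1 ⁻¹' (W : Set G)))
    (by
      refine directed_of_isDirected_le fun m n hmn g hg => ?_
      refine mem_orbitSubgroup_principal.2 fun k hk => mem_orbitSubgroup_principal.1 hg k ?_
      simp only [Set.mem_Icc] at hk ⊢
      omega)
    (fun N => isCompact_orbitSubgroup hWc hWo (by simp))
    (by
      intro g hg
      refine hO.mem_nhds ⟨g, mem_plusPart.2 fun n hn => ?_, 1, by simp, by simp⟩
      refine mem_orbitSubgroup_principal.1 (Set.mem_iInter.1 hg n.natAbs) n ?_
      simp only [Set.mem_Icc]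
      omega)
  refine ⟨N, fun u hu => ?_⟩
  obtain ⟨p, hp, r, hr, h⟩ := hN hu
  exact ⟨p, hp, r, hr, h.symm⟩

lemma exists_tidyAbove [T2Space G] (x : G) {W : Subgroup G}
    (hWc : IsCompact (W : Set G)) (hWo : IsOpen (W : Set G)) :
    ∃ N : ℕ, TidyAbove x (orbitSubgroup x W (𝓟 (Set.Icc (-N : ℤ) 0))) := by
  obtain ⟨N, hN⟩ := exists_orbitSubgroup_le_plusPart_mul x hWc hWo
  refine ⟨N, ?_⟩
  have hWcl := W.isClosed_of_isOpen hWo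
  -- every element of `⋂ 0 ≤ k ≤ N, xᵏ W x⁻ᵏ` factors through `V₊` up to any finite stage
  have key : ∀ u ∈ orbitSubgroup x W (𝓟 (Set.Icc (-N : ℤ) 0)), ∀ k : ℕ,
      ∃ p ∈ plusPart x W, p⁻¹ * u ∈ orbitSubgroup x W (𝓟 (Set.Icc (-N : ℤ) k)) := by
    intro u hu k
    induction k with
    | zero => exact ⟨1, one_mem _, by simpa using hu⟩
    | succ k ih =>
      obtain ⟨p, hp, hw⟩ := ih
      rw [mem_orbitSubgroup_principal] at hw
      obtain ⟨p', hp', r, hr, h⟩ := hN (conjPow x k (p⁻¹ * u)) <|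
        mem_orbitSubgroup_principal.2 fun n hn => by
          rw [conjPow_conjPow]
          simp only [Set.mem_Icc] at hn
          exact hw _ (by simp only [Set.mem_Icc]; omega)
      refine ⟨p * conjPow x (-k) p', mul_mem hp (conjPow_mem_plusPart hp' (by omega)), ?_⟩
      have e : (p * conjPow x (-k) p')⁻¹ * u = conjPow x (-k) r := by
        have : conjPow x (-k) (conjPow x k (p⁻¹ * u)) = conjPow x (-k) p' * conjPow x (-k) r := by
          rw [h, map_mul]
        rw [conjPow_conjPow, neg_add_cancel, conjPow_zero] at this
        rw [mul_inv_rev, mul_assoc, this, inv_mul_cancel_left]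
      rw [mem_orbitSubgroup_principal]
      intro n hn
      simp only [Set.mem_Icc] at hn
      rcases eq_or_lt_of_le hn.2 with rfl | hlt
      · have h1 : ((k + 1 : ℕ) : ℤ) + -k = 1 := by push_cast; ring
        rwa [e, conjPow_conjPow, h1]
      · rw [mul_inv_rev, mul_assoc, map_mul, map_inv, conjPow_conjPow]
        exact mul_mem (inv_mem (mem_plusPart.1 hp' _ (by push_cast at hlt; omega)))
          (hw n (by simp only [Set.mem_Icc]; push_cast at hlt; omega))
  intro v hv
  -- compactness of `V₊` yields a single factor that works at all stages
  have key' : ∀ u ∈ orbitSubgroup x W (𝓟 (Set.Icc (-N : ℤ) 0)),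
      ∃ p ∈ plusPart x W, ∀ n : ℤ, -N ≤ n → conjPow x n (p⁻¹ * u) ∈ W := by
    intro u hu
    have hcl : ∀ k : ℕ, IsClosed ((plusPart x W : Set G) ∩
        (fun p => p⁻¹ * u) ⁻¹' (orbitSubgroup x W (𝓟 (Set.Icc (-N : ℤ) k)) : Set G)) := fun k =>
      (isClosed_orbitSubgroup hWcl _).inter
        ((isClosed_orbitSubgroup hWcl _).preimage (by fun_prop))
    obtain ⟨p, hp⟩ := IsCompact.nonempty_iInter_of_sequence_nonempty_isCompact_isClosed
      (fun k : ℕ => (plusPart x W : Set G) ∩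
        (fun p => p⁻¹ * u) ⁻¹' (orbitSubgroup x W (𝓟 (Set.Icc (-N : ℤ) k)) : Set G))
      (fun k p hp => ⟨hp.1, mem_orbitSubgroup_principal.2 fun n hn =>
        mem_orbitSubgroup_principal.1 hp.2 n ⟨hn.1, hn.2.trans (by push_cast; omega)⟩⟩)
      (fun k => (key u hu k).imp fun p hp => ⟨hp.1, hp.2⟩)
      ((isCompact_orbitSubgroup hWc hWo (by simp)).of_isClosed_subset (hcl 0)
        Set.inter_subset_left) hcl
    rw [Set.mem_iInter] at hp
    exact ⟨p, (hp 0).1, fun n hn =>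
      mem_orbitSubgroup_principal.1 (hp n.toNat).2 n ⟨hn, Int.self_le_toNat n⟩⟩
  obtain ⟨p, hp, hq⟩ := key' v⁻¹ (inv_mem hv)
  refine ⟨(p⁻¹ * v⁻¹)⁻¹, inv_mem (mem_minusPart.2 fun n hn => ?_), p⁻¹,
    inv_mem (mem_plusPart.2 fun n hn => ?_), by group⟩
  · refine mem_orbitSubgroup_principal.2 fun m hm => ?_
    rw [conjPow_conjPow]
    exact hq _ (by have := hm.1; omega)
  · refine mem_orbitSubgroup_principal.2 fun m hm => ?_
    rw [conjPow_conjPow]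
    exact mem_plusPart.1 hp _ (by have := hm.2; omega)

end Topology

end Orbit

section Homoclinic

variable {G : Type*} [Group G] [TopologicalSpace G] [IsTopologicalGroup G]
  {x : G} {V : Subgroup G}

/-! ### The homoclinic subgroup -/

/-- Homoclinic elements of `x V₊ x⁻¹` are covered by finitely many cosets of the homoclinic
elements of `V₊`. -/
lemma exists_finite_cover_conjPow_homoclinic (hVc : IsCompact (V : Set G))
    (hVo : IsOpen (V : Set G)) :
    ∃ S : Set G, S.Finite ∧ S ⊆ homoclinic x V ∧
      ∀ g ∈ homoclinic x V ⊓ plusPart x V, ∃ s ∈ S, s⁻¹ * conjPow x 1 g ∈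
        homoclinic x V ⊓ plusPart x V := by
  set A := (homoclinic x V ⊓ plusPart x V).map (conjPow x 1) with hA
  have hfin : ((QuotientGroup.mk : G → G ⧸ V) '' (A : Set G)).Finite := by
    have : DiscreteTopology (G ⧸ V) := QuotientGroup.discreteTopology hVo
    refine (((hVc.image (continuous_conjPow x 1)).image
      QuotientGroup.continuous_mk).finite_of_discrete).subset ?_
    rintro _ ⟨_, ⟨g, hg, rfl⟩, rfl⟩
    exact ⟨_, ⟨g, plusPart_le hg.2, rfl⟩, rfl⟩
  obtain ⟨S, hSA, hbij⟩ := Set.exists_subset_bijOn (A : Set G) (QuotientGroup.mk : G → G ⧸ V)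
  have hS := hbij.image_eq
  refine ⟨S, hbij.finite_iff_finite.2 hfin, fun s hs => ?_, fun g hg => ?_⟩
  · obtain ⟨g, hg, rfl⟩ := hSA hs
    exact conjPow_mem_homoclinic hg.1 1
  · have : (QuotientGroup.mk (conjPow x 1 g) : G ⧸ V) ∈ QuotientGroup.mk '' S := by
      rw [hS]
      exact ⟨_, ⟨g, hg, rfl⟩, rfl⟩
    obtain ⟨s, hs, hsg⟩ := this
    obtain ⟨a, ha, rfl⟩ := hSA hs
    refine ⟨_, hs, ?_⟩
    have hV : (conjPow x 1 a)⁻¹ * conjPow x 1 g ∈ V := QuotientGroup.eq.1 hsg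
    have hb : a⁻¹ * g ∈ homoclinic x V ⊓ plusPart x V := mul_mem (inv_mem ha) hg
    rw [← map_inv, ← map_mul] at hV ⊢
    refine ⟨conjPow_mem_homoclinic hb.1 1, mem_plusPart.2 fun n hn => ?_⟩
    rcases eq_or_lt_of_le hn with rfl | hlt
    · simpa using hV
    · rw [conjPow_conjPow]
      exact mem_plusPart.1 hb.2 _ (by omega)

/-- The homoclinic subgroup of a compact open subgroup is relatively compact: only finitely many
coset representatives occur in `exists_finite_cover_conjPow_homoclinic`, and high conjugates of
these lie in `V`. -/
lemma exists_isCompact_homoclinic_subset (hVc : IsCompact (V : Set G))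
    (hVo : IsOpen (V : Set G)) :
    ∃ K : Set G, IsCompact K ∧ (homoclinic x V : Set G) ⊆ K := by
  obtain ⟨S, hSfin, hSh, hS⟩ := exists_finite_cover_conjPow_homoclinic (x := x) hVc hVo
  have hN : ∀ᶠ n : ℤ in atTop, ∀ s ∈ S, conjPow x n s ∈ V :=
    (eventually_all_finite hSfin).2 fun s hs => (mem_homoclinic.1 (hSh hs)).2
  obtain ⟨N, hN⟩ := eventually_atTop.1 hN
  have key : ∀ j : ℕ, ∀ g ∈ homoclinic x V ⊓ plusPart x V,
      ∃ v ∈ V, ∃ a ∈ V, conjPow x (N + j) g = v * conjPow x N a := by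
    intro j
    induction j with
    | zero =>
      intro g hg
      exact ⟨1, one_mem _, g, plusPart_le hg.2, by simp⟩
    | succ j ih =>
      intro g hg
      obtain ⟨s, hs, hsg⟩ := hS g hg
      obtain ⟨v, hv, a, ha, h⟩ := ih _ hsg
      refine ⟨conjPow x (N + j) s * v, mul_mem (hN _ (by omega) s hs) hv, a, ha, ?_⟩
      rw [mul_assoc, ← h, ← map_mul, mul_inv_cancel_left, conjPow_conjPow]
      push_cast
      rw [add_assoc]
  refine ⟨(V : Set G) * (conjPow x N '' V), hVc.mul (hVc.image (continuous_conjPow x N)), ?_⟩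
  intro g hg
  obtain ⟨M, hM⟩ := eventually_atBot.1 (mem_homoclinic.1 hg).1
  obtain ⟨j, hj⟩ : ∃ j : ℕ, -(N + j) ≤ M := ⟨(-M - N).toNat, by omega⟩
  obtain ⟨v, hv, a, ha, h⟩ := key j (conjPow x (-(N + j)) g)
    ⟨conjPow_mem_homoclinic hg _, mem_plusPart.2 fun n hn => by
      rw [conjPow_conjPow]
      exact hM _ (by omega)⟩
  rw [conjPow_conjPow, add_neg_cancel, conjPow_zero] at h
  exact ⟨v, hv, _, ⟨a, ha, rfl⟩, h.symm⟩

lemma isCompact_topologicalClosure_homoclinic (hVc : IsCompact (V : Set G))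
    (hVo : IsOpen (V : Set G)) :
    IsCompact ((homoclinic x V).topologicalClosure : Set G) := by
  obtain ⟨K, hK, h⟩ := exists_isCompact_homoclinic_subset (x := x) hVc hVo
  exact hK.closure_of_subset h

lemma conjPow_mem_topologicalClosure_homoclinic {g : G}
    (hg : g ∈ (homoclinic x V).topologicalClosure) (k : ℤ) :
    conjPow x k g ∈ (homoclinic x V).topologicalClosure :=
  map_mem_closure (continuous_conjPow x k) hg fun _ h => conjPow_mem_homoclinic h k

/-- If `V` is tidy above, then so is its intersection with the closure of its homoclinic
subgroup. -/
lemma TidyAbove.exists_mul_of_mem_closure_homoclinic [T2Space G] (hV : TidyAbove x V)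
    (hVc : IsCompact (V : Set G)) (hVo : IsOpen (V : Set G)) {l : G}
    (hl : l ∈ (homoclinic x V).topologicalClosure) (hlV : l ∈ V) :
    ∃ a ∈ (homoclinic x V).topologicalClosure ⊓ minusPart x V,
      ∃ b ∈ (homoclinic x V).topologicalClosure ⊓ plusPart x V, l = a * b := by
  set L := (homoclinic x V).topologicalClosure with hL
  have hLc : IsCompact (L : Set G) := isCompact_topologicalClosure_homoclinic hVc hVo
  have hVcl := V.isClosed_of_isOpen hVo
  have hcl : IsClosed (((L ⊓ minusPart x V : Subgroup G) : Set G) *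
      ((L ⊓ plusPart x V : Subgroup G) : Set G)) :=
    ((hLc.inter_right (isClosed_orbitSubgroup hVcl _)).mul
      (hLc.inter_right (isClosed_orbitSubgroup hVcl _))).isClosed
  have hsub : (V : Set G) ∩ (homoclinic x V : Set G) ⊆
      ((L ⊓ minusPart x V : Subgroup G) : Set G) * ((L ⊓ plusPart x V : Subgroup G) : Set G) := by
    rintro g ⟨hgV, hg⟩
    obtain ⟨a, ha, b, hb, rfl⟩ := hV g hgV
    have hg' := mem_homoclinic.1 hg
    have ha' : a ∈ homoclinic x V := mem_homoclinic.2
      ⟨by simpa using mul_mem hg'.1 (inv_mem (plusPart_le_atBot hb)), minusPart_le_atTop ha⟩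
    have hb' : b ∈ homoclinic x V := by simpa using mul_mem (inv_mem ha') hg
    exact ⟨a, ⟨Subgroup.le_topologicalClosure _ ha', ha⟩, b,
      ⟨Subgroup.le_topologicalClosure _ hb', hb⟩, rfl⟩
  obtain ⟨a, ha, b, hb, h⟩ := closure_minimal hsub hcl (hVo.inter_closure ⟨hlV, hl⟩)
  exact ⟨a, ha, b, hb, h.symm⟩

/-- Elements whose forward orbit stays close to `L` differ from an element of `L` by an element of
`V₋`. The approximating elements of `L` are corrected one step at a time by elements of `L ∩ V₊`,
which do not affect earlier steps, and compactness of `L` gives the limit. -/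
lemma exists_inv_mul_mem_minusPart (hVo : IsOpen (V : Set G)) {L : Subgroup G}
    (hLc : IsCompact (L : Set G)) (hLcl : IsClosed (L : Set G))
    (hLx : ∀ l ∈ L, ∀ k, conjPow x k l ∈ L)
    (hLV : ∀ l ∈ L, l ∈ V → ∃ a ∈ L ⊓ minusPart x V, ∃ b ∈ L ⊓ plusPart x V, l = a * b)
    {g : G} (hg : ∀ n : ℤ, 0 ≤ n → ∃ l ∈ L, ∃ v ∈ V, conjPow x 1 v ∈ V ∧ conjPow x n g = l * v) :
    ∃ m ∈ L, m⁻¹ * g ∈ minusPart x V := by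
  have key : ∀ n : ℕ, ∃ m ∈ L, (∀ k : ℤ, 0 ≤ k → k ≤ n → conjPow x k (m⁻¹ * g) ∈ V) ∧
      ∃ l ∈ L, ∃ v ∈ V, conjPow x 1 v ∈ V ∧ conjPow x n g = l * v ∧
        l⁻¹ * conjPow x n m ∈ minusPart x V := by
    intro n
    induction n with
    | zero =>
      obtain ⟨l, hl, v, hv, hv1, h⟩ := hg 0 le_rfl
      rw [conjPow_zero] at h
      refine ⟨l, hl, fun k hk hk' => ?_, l, hl, v, hv, hv1, by simpa using h, by simp⟩
      obtain rfl : k = 0 := by push_cast at hk'; omega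
      simpa [h] using hv
    | succ n ih =>
      obtain ⟨m, hm, hmk, l, hl, v, hv, hv1, h, hβ⟩ := ih
      obtain ⟨l', hl', v', hv', hv1', h'⟩ := hg (n + 1 : ℕ) (by omega)
      have e1 : conjPow x (n + 1 : ℕ) m = conjPow x 1 (conjPow x n m) := by
        rw [conjPow_conjPow]; push_cast; rw [add_comm]
      have hstep : l' * v' = conjPow x 1 l * conjPow x 1 v := by
        rw [← map_mul, ← h, conjPow_conjPow, ← h']; push_cast; rw [add_comm]
      have hc : l'⁻¹ * conjPow x 1 l ∈ V := by
        have : l'⁻¹ * conjPow x 1 l = v' * (conjPow x 1 v)⁻¹ := by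
          rw [inv_mul_eq_iff_eq_mul, ← mul_assoc, hstep, mul_inv_cancel_right]
        rw [this]
        exact mul_mem hv' (inv_mem hv1)
      have hd : l'⁻¹ * conjPow x (n + 1 : ℕ) m =
          (l'⁻¹ * conjPow x 1 l) * conjPow x 1 (l⁻¹ * conjPow x n m) := by
        rw [e1, map_mul, map_inv]; group
      obtain ⟨a, ha, b, hb, hab⟩ := hLV (l'⁻¹ * conjPow x (n + 1 : ℕ) m)
        (mul_mem (inv_mem hl') (hLx m hm _))
        (by
          rw [hd]
          exact mul_mem hc (minusPart_le (conjPow_mem_minusPart hβ zero_le_one)))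
      have e2 : conjPow x (n + 1 : ℕ) (m * conjPow x (-(n + 1 : ℕ)) b⁻¹) = l' * a := by
        rw [map_mul, conjPow_conjPow, add_neg_cancel, conjPow_zero, mul_inv_eq_iff_eq_mul,
          mul_assoc, ← hab, mul_inv_cancel_left]
      refine ⟨m * conjPow x (-(n + 1 : ℕ)) b⁻¹, mul_mem hm (hLx _ (inv_mem hb.1) _),
        fun k hk hkn => ?_, l', hl', v', hv', hv1', h', ?_⟩
      · rcases eq_or_lt_of_le hkn with rfl | hlt
        · rw [map_mul, map_inv, e2, h', mul_inv_rev, mul_assoc, inv_mul_cancel_left]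
          exact mul_mem (inv_mem (minusPart_le ha.2)) hv'
        · have e3 : (m * conjPow x (-(n + 1 : ℕ)) b⁻¹)⁻¹ * g =
              conjPow x (-(n + 1 : ℕ)) b * (m⁻¹ * g) := by
            rw [map_inv]; group
          rw [e3, map_mul, conjPow_conjPow]
          exact mul_mem (mem_plusPart.1 hb.2 _ (by omega))
            (hmk k hk (by push_cast at hlt; omega))
      · rw [e2, inv_mul_cancel_left]
        exact ha.2
  have hVcl := V.isClosed_of_isOpen hVo
  have hcl : ∀ n : ℕ, IsClosed ((L : Set G) ∩
      (fun m => m⁻¹ * g) ⁻¹' (orbitSubgroup x V (𝓟 (Set.Icc (0 : ℤ) n)) : Set G)) := fun k =>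
    hLcl.inter ((isClosed_orbitSubgroup hVcl _).preimage (by fun_prop))
  obtain ⟨m, hm⟩ := IsCompact.nonempty_iInter_of_sequence_nonempty_isCompact_isClosed
    (fun n : ℕ => (L : Set G) ∩
      (fun m => m⁻¹ * g) ⁻¹' (orbitSubgroup x V (𝓟 (Set.Icc (0 : ℤ) n)) : Set G))
    (fun k p hp => ⟨hp.1, mem_orbitSubgroup_principal.2 fun n hn =>
      mem_orbitSubgroup_principal.1 hp.2 n ⟨hn.1, hn.2.trans (by push_cast; omega)⟩⟩)
    (fun n => by
      obtain ⟨m, hm, h, -⟩ := key n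
      exact ⟨m, hm, mem_orbitSubgroup_principal.2 fun k hk => h k hk.1 hk.2⟩)
    (hLc.of_isClosed_subset (hcl 0) Set.inter_subset_left) hcl
  rw [Set.mem_iInter] at hm
  exact ⟨m, (hm 0).1, mem_minusPart.2 fun n hn =>
    mem_orbitSubgroup_principal.1 (hm n.toNat).2 n ⟨hn, Int.self_le_toNat n⟩⟩

/-- Version of `exists_inv_mul_mem_minusPart` for orbits that are eventually close to `L`. -/
lemma exists_inv_mul_mem_atTop (hVo : IsOpen (V : Set G)) {L : Subgroup G}
    (hLc : IsCompact (L : Set G)) (hLcl : IsClosed (L : Set G))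
    (hLx : ∀ l ∈ L, ∀ k, conjPow x k l ∈ L)
    (hLV : ∀ l ∈ L, l ∈ V → ∃ a ∈ L ⊓ minusPart x V, ∃ b ∈ L ⊓ plusPart x V, l = a * b)
    {g : G} (hg : ∀ᶠ n : ℤ in atTop,
      ∃ l ∈ L, ∃ v ∈ V, conjPow x 1 v ∈ V ∧ conjPow x n g = l * v) :
    ∃ m ∈ L, m⁻¹ * g ∈ orbitSubgroup x V atTop := by
  obtain ⟨N, hN⟩ := eventually_atTop.1 hg
  obtain ⟨m, hm, h⟩ := exists_inv_mul_mem_minusPart (g := conjPow x N g) hVo hLc hLcl hLx hLV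
    fun n hn => by
      rw [conjPow_conjPow]
      exact hN _ (by omega)
  refine ⟨conjPow x (-N) m, hLx m hm _, ?_⟩
  have := conjPow_mem_atTop (minusPart_le_atTop h) (-N)
  rwa [map_mul, conjPow_conjPow, neg_add_cancel, conjPow_zero, map_inv] at this

/-- Let `L` be the closure of the homoclinic subgroup of `V`, with `V` tidy above. Enlarging `V` to
a group contained in a small neighbourhood of `L` creates no homoclinic elements outside `L`. -/
lemma TidyAbove.homoclinic_le_topologicalClosure [T2Space G] (hV : TidyAbove x V)
    (hVc : IsCompact (V : Set G)) (hVo : IsOpen (V : Set G)) {W : Subgroup G}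
    (hW : ∀ w ∈ W, ∃ l ∈ (homoclinic x V).topologicalClosure,
      ∃ v ∈ orbitSubgroup x V (𝓟 {-1, 0, 1}), w = l * v) :
    homoclinic x W ≤ (homoclinic x V).topologicalClosure := by
  set L := (homoclinic x V).topologicalClosure with hL
  have hLc : IsCompact (L : Set G) := isCompact_topologicalClosure_homoclinic hVc hVo
  have hLcl : IsClosed (L : Set G) := Subgroup.isClosed_topologicalClosure _
  have hLx : ∀ l ∈ L, ∀ k, conjPow x k l ∈ L := fun l hl k =>
    conjPow_mem_topologicalClosure_homoclinic hl k
  have hLV : ∀ l ∈ L, l ∈ V → ∃ a ∈ L ⊓ minusPart x V, ∃ b ∈ L ⊓ plusPart x V, l = a * b :=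
    fun l hl hlV => hV.exists_mul_of_mem_closure_homoclinic hVc hVo hl hlV
  intro g hg
  rw [mem_homoclinic] at hg
  obtain ⟨l₁, hl₁, hq⟩ := exists_inv_mul_mem_atTop hVo hLc hLcl hLx hLV (g := g)
    (hg.2.mono fun n hn => by
      obtain ⟨l, hl, v, hv, h⟩ := hW _ hn
      rw [mem_orbitSubgroup_principal] at hv
      exact ⟨l, hl, v, by simpa using hv 0 (by simp), hv 1 (by simp), h⟩)
  -- the same statement for `x⁻¹` controls the backward orbit
  obtain ⟨l₂, hl₂, hp⟩ := exists_inv_mul_mem_atTop (x := x⁻¹) hVo hLc hLcl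
    (fun l hl k => by rw [conjPow_inv_base]; exact hLx l hl _)
    (fun l hl hlV => by
      obtain ⟨a, ha, b, hb, h⟩ := hLV l⁻¹ (inv_mem hl) (inv_mem hlV)
      rw [minusPart_inv_base, plusPart_inv_base]
      exact ⟨b⁻¹, inv_mem hb, a⁻¹, inv_mem ha, by rw [← mul_inv_rev, ← h, inv_inv]⟩) (g := g)
    ((tendsto_neg_atTop_atBot.eventually hg.1).mono fun n hn => by
      obtain ⟨l, hl, v, hv, h⟩ := hW _ hn
      rw [mem_orbitSubgroup_principal] at hv
      refine ⟨l, hl, v, by simpa using hv 0 (by simp), ?_, ?_⟩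
      · rw [conjPow_inv_base]; exact hv (-1) (by simp)
      · rw [conjPow_inv_base]; exact h)
  have hp' : l₂⁻¹ * g ∈ orbitSubgroup x V atBot := by
    refine (tendsto_neg_atBot_atTop.eventually hp).mono fun n hn => ?_
    rwa [conjPow_inv_base, neg_neg] at hn
  -- factor `l₁⁻¹ l₂ = u a b` with `u` homoclinic, `a ∈ V₋`, `b ∈ V₊`
  have hl : l₁⁻¹ * l₂ ∈ L := mul_mem (inv_mem hl₁) hl₂
  obtain ⟨u, huV, hu⟩ : ∃ u, u⁻¹ * (l₁⁻¹ * l₂) ∈ V ∧ u ∈ homoclinic x V := by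
    have hnhds : {u : G | u⁻¹ * (l₁⁻¹ * l₂) ∈ V} ∈ 𝓝 (l₁⁻¹ * l₂) := by
      refine IsOpen.mem_nhds ?_ (by simp)
      exact hVo.preimage (f := fun u : G => u⁻¹ * (l₁⁻¹ * l₂)) (by fun_prop)
    exact mem_closure_iff_nhds.1 hl _ hnhds
  obtain ⟨a, ha, b, hb, hab⟩ := hLV _
    (mul_mem (inv_mem (Subgroup.le_topologicalClosure _ hu)) hl) huV
  have hmem : b * (l₂⁻¹ * g) ∈ homoclinic x V := by
    refine mem_homoclinic.2 ⟨mul_mem (plusPart_le_atBot hb.2) hp', ?_⟩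
    have : b * (l₂⁻¹ * g) = a⁻¹ * (u⁻¹ * (l₁⁻¹ * g)) := by
      rw [eq_inv_mul_iff_mul_eq, ← mul_assoc, ← hab]; group
    rw [this]
    exact mul_mem (inv_mem (minusPart_le_atTop ha.2)) (mul_mem (inv_mem (mem_homoclinic.1 hu).2) hq)
  have : g = l₂ * (b⁻¹ * (b * (l₂⁻¹ * g))) := by group
  rw [this]
  exact mul_mem hl₂ (mul_mem (inv_mem hb.1) (Subgroup.le_topologicalClosure _ hmem))

/-! ### Existence of tidy subgroups -/

/-- A compact group `L` has arbitrarily small neighbourhoods of the form `L V'` that are compact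
open subgroups. -/
lemma exists_subgroup_le_mul [T2Space G] {L U : Subgroup G} (hLc : IsCompact (L : Set G))
    (hUc : IsCompact (U : Set G)) (hUo : IsOpen (U : Set G)) :
    ∃ W : Subgroup G, IsCompact (W : Set G) ∧ IsOpen (W : Set G) ∧ L ≤ W ∧
      ∀ w ∈ W, ∃ l ∈ L, ∃ u ∈ U, w = l * u := by
  let C : Subgroup G :=
    { carrier := {g | ∀ l ∈ L, l * g * l⁻¹ ∈ U}
      one_mem' := by simp
      mul_mem' := by
        intro a b ha hb l hl
        simpa [mul_assoc] using mul_mem (ha l hl) (hb l hl)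
      inv_mem' := by
        intro a ha l hl
        simpa [mul_assoc] using inv_mem (ha l hl) }
  have hCU : C ≤ U := fun g hg => by simpa using hg 1 (one_mem _)
  have hCL : ∀ c ∈ C, ∀ l ∈ L, l * c * l⁻¹ ∈ C := fun c hc l hl k hk => by
    simpa [mul_assoc] using hc (k * l) (mul_mem hk hl)
  have hCo : IsOpen (C : Set G) := by
    refine C.isOpen_of_mem_nhds (g := 1) ?_
    refine hLc.eventually_forall_of_forall_eventually fun l hl => ?_
    have hc : Continuous fun p : G × G => p.2 * p.1 * p.2⁻¹ := by fun_prop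
    exact hc.continuousAt.eventually_mem (hUo.mem_nhds (by simp))
  have hCc : IsCompact (C : Set G) :=
    hUc.of_isClosed_subset (C.isClosed_of_isOpen hCo) hCU
  let W : Subgroup G :=
    { carrier := (L : Set G) * (C : Set G)
      one_mem' := ⟨1, one_mem _, 1, one_mem _, one_mul 1⟩
      mul_mem' := by
        rintro _ _ ⟨l, hl, c, hc, rfl⟩ ⟨l', hl', c', hc', rfl⟩
        exact ⟨l * l', mul_mem hl hl', (l'⁻¹ * c * l'⁻¹⁻¹) * c',
          mul_mem (hCL c hc _ (inv_mem hl')) hc', by simp [mul_assoc]⟩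
      inv_mem' := by
        rintro _ ⟨l, hl, c, hc, rfl⟩
        exact ⟨l⁻¹, inv_mem hl, l * c⁻¹ * l⁻¹, hCL _ (inv_mem hc) _ hl, by simp [mul_assoc]⟩ }
  refine ⟨W, hLc.mul hCc, hCo.mul_left, fun l hl => ⟨l, hl, 1, one_mem _, mul_one l⟩, ?_⟩
  rintro _ ⟨l, hl, c, hc, rfl⟩
  exact ⟨l, hl, c, hCU hc, rfl⟩

/-- Van Dantzig's theorem: the stabilizer of a compact open neighbourhood of `1` under left
translation is a compact open subgroup. -/
lemma exists_isCompact_isOpen_subgroup (G : Type*) [Group G] [TopologicalSpace G]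
    [IsTopologicalGroup G] [LocallyCompactSpace G] [TotallyDisconnectedSpace G] :
    ∃ V : Subgroup G, IsCompact (V : Set G) ∧ IsOpen (V : Set G) := by
  obtain ⟨K, hK, hK1⟩ := exists_compact_mem_nhds (1 : G)
  obtain ⟨W, hW, h1W, hWK⟩ := loc_compact_Haus_tot_disc_of_zero_dim.mem_nhds_iff.1 hK1
  have hWc : IsCompact W := hK.of_isClosed_subset hW.1 hWK
  have hnhds : ∀ᶠ g : G in 𝓝 1, ∀ w ∈ W, g * w ∈ W :=
    hWc.eventually_forall_of_forall_eventually fun w hw =>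
      (continuous_mul.continuousAt (x := ((1 : G), w))).eventually_mem
        (hW.2.mem_nhds (by simpa using hw))
  have hinv : ∀ᶠ g : G in 𝓝 1, ∀ w ∈ W, g⁻¹ * w ∈ W :=
    (continuous_inv.tendsto' (1 : G) 1 inv_one).eventually hnhds
  let V := MulAction.stabilizer G W
  have hVo : IsOpen (V : Set G) := by
    refine V.isOpen_of_mem_nhds (g := 1) ?_
    filter_upwards [hnhds, hinv] with g hg hg'
    refine MulAction.mem_stabilizer_iff.2 (Set.Subset.antisymm ?_ fun w hw => ?_)
    · rintro _ ⟨w, hw, rfl⟩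
      exact hg w hw
    · exact ⟨g⁻¹ * w, hg' w hw, by simp⟩
  refine ⟨V, hWc.of_isClosed_subset (V.isClosed_of_isOpen hVo) fun g hg => ?_, hVo⟩
  have : g • (1 : G) ∈ g • W := Set.smul_mem_smul_set h1W
  rwa [MulAction.mem_stabilizer_iff.1 hg, smul_eq_mul, mul_one] at this

/-- Every element has a tidy subgroup: one that is tidy above and contains its homoclinic
subgroup. -/
theorem exists_tidy [LocallyCompactSpace G] [TotallyDisconnectedSpace G] (x : G) :
    ∃ V : Subgroup G, IsCompact (V : Set G) ∧ IsOpen (V : Set G) ∧ TidyAbove x V ∧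
      homoclinic x V ≤ V := by
  obtain ⟨V₀, hV₀c, hV₀o⟩ := exists_isCompact_isOpen_subgroup G
  obtain ⟨N, hV⟩ := exists_tidyAbove x hV₀c hV₀o
  set V := orbitSubgroup x V₀ (𝓟 (Set.Icc (-N : ℤ) 0)) with hVdef
  have hVc : IsCompact (V : Set G) := isCompact_orbitSubgroup hV₀c hV₀o (by simp)
  have hVo : IsOpen (V : Set G) := isOpen_orbitSubgroup hV₀o (Set.finite_Icc _ _)
  obtain ⟨W, hWc, hWo, hLW, hW⟩ := exists_subgroup_le_mul
    (isCompact_topologicalClosure_homoclinic (x := x) hVc hVo)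
    (isCompact_orbitSubgroup (x := x) hVc hVo (S := {-1, 0, 1}) (by simp))
    (isOpen_orbitSubgroup (x := x) hVo (S := {-1, 0, 1}) (Set.toFinite _))
  have hWL := hV.homoclinic_le_topologicalClosure hVc hVo hW
  obtain ⟨M, hM⟩ := exists_tidyAbove x hWc hWo
  refine ⟨_, isCompact_orbitSubgroup hWc hWo (by simp),
    isOpen_orbitSubgroup hWo (Set.finite_Icc _ _), hM, fun g hg => ?_⟩
  have hgL := hWL (orbitSubgroup_mono (fun w hw => by
    simpa using mem_orbitSubgroup_principal.1 hw 0 (by simp)) _ hg)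
  exact mem_orbitSubgroup_principal.2 fun n _ =>
    hLW (conjPow_mem_topologicalClosure_homoclinic hgL n)

end Homoclinic

/-! ### Indices of subgroups and conjugation -/

section Index

variable {G : Type*} [Group G]

lemma mem_conjSubgroup {x g : G} {V : Subgroup G} :
    g ∈ conjSubgroup x V ↔ x⁻¹ * g * x ∈ V := by
  constructor
  · rintro ⟨v, hv, rfl⟩
    simpa [mul_assoc] using hv
  · exact fun h => ⟨_, h, by simp [mul_assoc]⟩

@[simp] lemma conjSubgroup_one (V : Subgroup G) : conjSubgroup 1 V = V := by
  ext g; simp [mem_conjSubgroup]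

lemma conjSubgroup_mul (x y : G) (V : Subgroup G) :
    conjSubgroup (x * y) V = conjSubgroup x (conjSubgroup y V) := by
  ext g; simp [mem_conjSubgroup, mul_assoc]

lemma conjSubgroup_of_mem {v : G} {V : Subgroup G} (hv : v ∈ V) : conjSubgroup v V = V := by
  ext g
  rw [mem_conjSubgroup, mul_assoc, V.mul_mem_cancel_left (inv_mem hv), V.mul_mem_cancel_right hv]

lemma relIndex_conjSubgroup (x : G) (H K : Subgroup G) :
    (conjSubgroup x H).relIndex (conjSubgroup x K) = H.relIndex K :=
  Subgroup.relIndex_map_map_of_injective H K (MulAut.conj x).injective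

/-- Triangle inequality for relative indices. -/
lemma relIndex_le_relIndex_mul_relIndex {H K L : Subgroup G} (hHK : H.relIndex K ≠ 0)
    (hKL : K.relIndex L ≠ 0) : H.relIndex L ≤ H.relIndex K * K.relIndex L := by
  have h0 : H.relIndex (K ⊓ L) ≠ 0 := fun h =>
    hHK (Subgroup.relIndex_eq_zero_of_le_right inf_le_left h)
  calc H.relIndex L ≤ (H ⊓ K).relIndex L := by
        refine Subgroup.relIndex_le_of_le_left inf_le_left ?_
        rw [← Subgroup.relIndex_inf_mul_relIndex]
        exact mul_ne_zero h0 hKL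
    _ = H.relIndex (K ⊓ L) * K.relIndex L := (Subgroup.relIndex_inf_mul_relIndex ..).symm
    _ ≤ H.relIndex K * K.relIndex L :=
        Nat.mul_le_mul_right _ (Subgroup.relIndex_le_of_le_right inf_le_left hHK)

lemma relIndex_eq_of_le_mul {A' A B : Subgroup G} (hA : A' ≤ A)
    (h : ∀ a ∈ A, ∃ a' ∈ A', ∃ b ∈ B, a = a' * b) : B.relIndex A' = B.relIndex A := by
  refine Nat.card_congr (Equiv.ofBijective (Subgroup.quotientSubgroupOfEmbeddingOfLE B hA)
    ⟨(Subgroup.quotientSubgroupOfEmbeddingOfLE B hA).injective, fun q => ?_⟩)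
  induction q using QuotientGroup.induction_on with
  | H a =>
    obtain ⟨a', ha', b, hb, hab⟩ := h a a.2
    refine ⟨QuotientGroup.mk ⟨a', ha'⟩, QuotientGroup.eq.2 ?_⟩
    rw [Subgroup.mem_subgroupOf]
    simpa [hab] using hb

/-! ### Indices of tidy subgroups -/

variable {x : G} {V : Subgroup G}

/-- If `V` is tidy above and contains its homoclinic subgroup, then `V` is tidy below:
`V ∩ ⋃ n, xⁿ V₊ x⁻ⁿ = V₊`. -/
lemma TidyAbove.mem_plusPart_of_mem_atBot (hV : TidyAbove x V) (hh : homoclinic x V ≤ V) {g : G}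
    (hgV : g ∈ V) (hg : g ∈ orbitSubgroup x V atBot) : g ∈ plusPart x V := by
  obtain ⟨a, ha, b, hb, rfl⟩ := hV g hgV
  have ha' : a ∈ homoclinic x V := mem_homoclinic.2
    ⟨by simpa using mul_mem hg (inv_mem (plusPart_le_atBot hb)), minusPart_le_atTop ha⟩
  exact mul_mem (mem_plusPart.2 fun n _ => hh (conjPow_mem_homoclinic ha' n)) hb

lemma conj_pow_eq_conjPow (x g : G) (n : ℕ) : x ^ n * g * (x ^ n)⁻¹ = conjPow x n g := by
  rw [conjPow_apply, zpow_natCast]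

lemma inv_conj_pow_eq_conjPow (x g : G) (n : ℕ) : (x ^ n)⁻¹ * g * x ^ n = conjPow x (-n) g := by
  rw [conjPow_apply, zpow_neg, zpow_natCast, inv_inv]

lemma TidyAbove.relIndex_conjSubgroup_pow_eq (hV : TidyAbove x V) (hh : homoclinic x V ≤ V)
    (n : ℕ) : V.relIndex (conjSubgroup (x ^ n) V) =
      (plusPart x V).relIndex (conjSubgroup (x ^ n) (plusPart x V)) := by
  have h1 : V.relIndex (conjSubgroup (x ^ n) (plusPart x V)) =
      V.relIndex (conjSubgroup (x ^ n) V) := by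
    refine relIndex_eq_of_le_mul (Subgroup.map_mono plusPart_le) ?_
    rintro _ ⟨v, hv, rfl⟩
    obtain ⟨b, hb, a, ha, rfl⟩ := hV.exists_plus_mul_minus hv
    refine ⟨_, ⟨b, hb, rfl⟩, _, ?_, map_mul _ b a⟩
    change x ^ n * a * (x ^ n)⁻¹ ∈ V
    rw [conj_pow_eq_conjPow]
    exact mem_minusPart.1 ha _ (by omega)
  have h2 : V ⊓ conjSubgroup (x ^ n) (plusPart x V) = plusPart x V := by
    refine le_antisymm ?_ fun g hg => ⟨plusPart_le hg, mem_conjSubgroup.2 ?_⟩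
    · rintro _ ⟨hgV, p, hp, rfl⟩
      refine hV.mem_plusPart_of_mem_atBot hh hgV ?_
      change x ^ n * p * (x ^ n)⁻¹ ∈ _
      rw [conj_pow_eq_conjPow]
      exact conjPow_mem_atBot (plusPart_le_atBot hp) _
    · rw [inv_conj_pow_eq_conjPow]
      exact conjPow_mem_plusPart hg (by omega)
  rw [← h1, ← Subgroup.inf_relIndex_right, h2]

lemma plusPart_le_conjSubgroup (x : G) (V : Subgroup G) (n : ℕ) :
    plusPart x V ≤ conjSubgroup (x ^ n) (plusPart x V) := fun g hg => by
  rw [mem_conjSubgroup, inv_conj_pow_eq_conjPow]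
  exact conjPow_mem_plusPart hg (by omega)

lemma TidyAbove.relIndex_conjSubgroup_pow (hV : TidyAbove x V) (hh : homoclinic x V ≤ V) (n : ℕ) :
    V.relIndex (conjSubgroup (x ^ n) V) = V.relIndex (conjSubgroup x V) ^ n := by
  have h1 := hV.relIndex_conjSubgroup_pow_eq hh 1
  rw [pow_one] at h1
  rw [hV.relIndex_conjSubgroup_pow_eq hh, h1]
  induction n with
  | zero => simp
  | succ n ih =>
    have hstep := plusPart_le_conjSubgroup x V 1
    rw [pow_one] at hstep
    have hle : conjSubgroup (x ^ n) (plusPart x V) ≤ conjSubgroup (x ^ (n + 1)) (plusPart x V) := by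
      rw [pow_succ, conjSubgroup_mul]
      exact Subgroup.map_mono hstep
    rw [← Subgroup.relIndex_mul_relIndex _ _ _ (plusPart_le_conjSubgroup x V n) hle, ih,
      pow_succ x, conjSubgroup_mul, relIndex_conjSubgroup, pow_succ]

lemma conjPow_pow_base (x : G) (n : ℕ) (k : ℤ) (g : G) :
    conjPow (x ^ n) k g = conjPow x (n * k) g := by
  rw [conjPow_apply, conjPow_apply, zpow_mul, zpow_natCast]

lemma TidyAbove.pow (hV : TidyAbove x V) (n : ℕ) : TidyAbove (x ^ n) V := fun v hv => by
  obtain ⟨a, ha, b, hb, h⟩ := hV v hv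
  refine ⟨a, mem_minusPart.2 fun k hk => ?_, b, mem_plusPart.2 fun k hk => ?_, h⟩
  · rw [conjPow_pow_base]
    exact mem_minusPart.1 ha _ (by positivity)
  · rw [conjPow_pow_base]
    exact mem_plusPart.1 hb _ (mul_nonpos_of_nonneg_of_nonpos (by positivity) hk)

/-- If `V` is tidy above for `x`, then `(x v)ᵏ ∈ V xᵏ V` for `v ∈ V`. -/
lemma TidyAbove.exists_mul_pow_eq (hV : TidyAbove x V) {v : G} (hv : v ∈ V) (k : ℕ) :
    ∃ u ∈ V, ∃ w ∈ V, (x * v) ^ k = u * x ^ k * w := by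
  induction k with
  | zero => exact ⟨1, one_mem _, 1, one_mem _, by simp⟩
  | succ k ih =>
    obtain ⟨u, hu, w, hw, h⟩ := ih
    obtain ⟨a, ha, b, hb, hab⟩ := hV (v * u) (mul_mem hv hu)
    refine ⟨conjPow x 1 a, mem_minusPart.1 ha 1 zero_le_one, conjPow x (-k) b * w,
      mul_mem (mem_plusPart.1 hb _ (by omega)) hw, ?_⟩
    have e : (x * v) ^ (k + 1) = x * (v * u) * x ^ k * w := by rw [pow_succ', h]; group
    rw [e, hab, ← inv_conj_pow_eq_conjPow, conjPow_apply, zpow_one]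
    group

lemma relIndex_conjSubgroup_mul_mul {u w : G} (hu : u ∈ V) (hw : w ∈ V) (z : G) :
    V.relIndex (conjSubgroup (u * z * w) V) = V.relIndex (conjSubgroup z V) := by
  rw [conjSubgroup_mul, conjSubgroup_of_mem hw, conjSubgroup_mul]
  nth_rw 1 [← conjSubgroup_of_mem hu]
  rw [relIndex_conjSubgroup]

/-! ### The scale -/

variable [TopologicalSpace G] [IsTopologicalGroup G]

lemma isCompact_conjSubgroup (x : G) {V : Subgroup G} (hV : IsCompact (V : Set G)) :
    IsCompact (conjSubgroup x V : Set G) :=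
  hV.image (by change Continuous fun g => x * g * x⁻¹; fun_prop)

lemma isOpen_conjSubgroup (x : G) {V : Subgroup G} (hV : IsOpen (V : Set G)) :
    IsOpen (conjSubgroup x V : Set G) := by
  have : (conjSubgroup x V : Set G) = (fun g => x⁻¹ * g * x) ⁻¹' V := by
    ext g; exact mem_conjSubgroup
  rw [this]
  exact hV.preimage (by fun_prop)

lemma relIndex_ne_zero_of_isOpen_of_isCompact {V W : Subgroup G} (hV : IsOpen (V : Set G))
    (hW : IsCompact (W : Set G)) : V.relIndex W ≠ 0 := by
  have : CompactSpace W := isCompact_iff_compactSpace.1 hW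
  have : Finite (W ⧸ V.subgroupOf W) :=
    Subgroup.quotient_finite_of_isOpen _ (hV.preimage continuous_subtype_val)
  have : (V.subgroupOf W).FiniteIndex := Subgroup.finiteIndex_of_finite_quotient
  exact Subgroup.FiniteIndex.index_ne_zero (H := V.subgroupOf W)

lemma Nat.le_of_forall_pow_le_mul_pow {a b C : ℕ} (hb : b ≠ 0)
    (h : ∀ n, a ^ n ≤ C * b ^ n) : a ≤ b := by
  by_contra! hab
  have hb' : (0 : ℝ) < b := by positivity
  have h1 : (1 : ℝ) < a / b := (one_lt_div hb').2 (by exact_mod_cast hab)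
  obtain ⟨n, hn⟩ := pow_unbounded_of_one_lt (C : ℝ) h1
  rw [div_pow, lt_div_iff₀ (by positivity)] at hn
  exact absurd (h n) (not_le.2 (by exact_mod_cast hn))

lemma relIndex_conjSubgroup_pow_le {W : Subgroup G} (hWc : IsCompact (W : Set G))
    (hWo : IsOpen (W : Set G)) (y : G) (n : ℕ) :
    W.relIndex (conjSubgroup (y ^ n) W) ≤ W.relIndex (conjSubgroup y W) ^ n := by
  induction n with
  | zero => simp
  | succ n ih =>
    calc W.relIndex (conjSubgroup (y ^ (n + 1)) W)
        ≤ W.relIndex (conjSubgroup (y ^ n) W) *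
          (conjSubgroup (y ^ n) W).relIndex (conjSubgroup (y ^ (n + 1)) W) :=
          relIndex_le_relIndex_mul_relIndex
            (relIndex_ne_zero_of_isOpen_of_isCompact hWo (isCompact_conjSubgroup _ hWc))
            (relIndex_ne_zero_of_isOpen_of_isCompact (isOpen_conjSubgroup _ hWo)
              (isCompact_conjSubgroup _ hWc))
      _ ≤ W.relIndex (conjSubgroup y W) ^ (n + 1) := by
          rw [pow_succ y, conjSubgroup_mul, relIndex_conjSubgroup, pow_succ]
          exact Nat.mul_le_mul_right _ ih

/-- If the index `[yᵏVy⁻ᵏ : yᵏVy⁻ᵏ ∩ V]` is multiplicative in `k`, then `V` realizes the scale: up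
to a factor independent of `k`, this index is the same for any two compact open subgroups. -/
lemma scale_eq_of_relIndex_pow {V : Subgroup G} (hVc : IsCompact (V : Set G))
    (hVo : IsOpen (V : Set G)) {y : G}
    (hpow : ∀ k : ℕ, V.relIndex (conjSubgroup (y ^ k) V) = V.relIndex (conjSubgroup y V) ^ k) :
    scale y = V.relIndex (conjSubgroup y V) := by
  refine le_antisymm (Nat.sInf_le ⟨V, hVc, hVo, rfl⟩) ?_
  refine le_csInf ⟨_, V, hVc, hVo, rfl⟩ ?_
  rintro _ ⟨W, hWc, hWo, rfl⟩
  have hne : ∀ {H K : Subgroup G}, IsOpen (H : Set G) → IsCompact (K : Set G) →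
      H.relIndex K ≠ 0 := relIndex_ne_zero_of_isOpen_of_isCompact
  refine Nat.le_of_forall_pow_le_mul_pow (C := V.relIndex W * W.relIndex V)
    (hne hWo (isCompact_conjSubgroup _ hWc)) fun k => ?_
  have hV' := isCompact_conjSubgroup (y ^ k) hVc
  have hW' := isCompact_conjSubgroup (y ^ k) hWc
  have hWo' := isOpen_conjSubgroup (y ^ k) hWo
  calc V.relIndex (conjSubgroup y V) ^ k
      = V.relIndex (conjSubgroup (y ^ k) V) := (hpow k).symm
    _ ≤ V.relIndex W * W.relIndex (conjSubgroup (y ^ k) V) :=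
        relIndex_le_relIndex_mul_relIndex (hne hVo hWc) (hne hWo hV')
    _ ≤ V.relIndex W * (W.relIndex (conjSubgroup (y ^ k) W) *
          (conjSubgroup (y ^ k) W).relIndex (conjSubgroup (y ^ k) V)) :=
        Nat.mul_le_mul_left _ (relIndex_le_relIndex_mul_relIndex (hne hWo hW') (hne hWo' hV'))
    _ = V.relIndex W * W.relIndex V * W.relIndex (conjSubgroup (y ^ k) W) := by
        rw [relIndex_conjSubgroup]; ring
    _ ≤ V.relIndex W * W.relIndex V * W.relIndex (conjSubgroup y W) ^ k :=
        Nat.mul_le_mul_left _ (relIndex_conjSubgroup_pow_le hWc hWo y k)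

lemma scale_conj (g x : G) : scale (g * x * g⁻¹) = scale x := by
  have key : ∀ g x : G, ∀ k, (∃ V : Subgroup G, IsCompact (V : Set G) ∧ IsOpen (V : Set G) ∧
      k = V.relIndex (conjSubgroup x V)) → ∃ V : Subgroup G, IsCompact (V : Set G) ∧
      IsOpen (V : Set G) ∧ k = V.relIndex (conjSubgroup (g * x * g⁻¹) V) := by
    rintro g x _ ⟨V, hVc, hVo, rfl⟩
    refine ⟨_, isCompact_conjSubgroup g hVc, isOpen_conjSubgroup g hVo, ?_⟩
    rw [← conjSubgroup_mul, inv_mul_cancel_right, conjSubgroup_mul, relIndex_conjSubgroup]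
  unfold scale
  congr 1
  ext k
  refine ⟨fun h => ?_, key g x k⟩
  simpa [mul_assoc] using key g⁻¹ _ k h

/-- The scale of `x ^ n` is the `n`-th power of that of `x`, and is unchanged by right
multiplication by elements of a tidy subgroup. -/
theorem TidyAbove.scale_pow_mul (hV : TidyAbove x V) (hh : homoclinic x V ≤ V)
    (hVc : IsCompact (V : Set G)) (hVo : IsOpen (V : Set G)) (n : ℕ) {v : G} (hv : v ∈ V) :
    scale (x ^ n * v) = scale x ^ n := by
  have hpow : ∀ k : ℕ, V.relIndex (conjSubgroup ((x ^ n * v) ^ k) V) =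
      (V.relIndex (conjSubgroup x V) ^ n) ^ k := fun k => by
    obtain ⟨u, hu, w, hw, h⟩ := (hV.pow n).exists_mul_pow_eq hv k
    rw [h, relIndex_conjSubgroup_mul_mul hu hw, ← pow_mul, hV.relIndex_conjSubgroup_pow hh,
      pow_mul]
  have h1 : V.relIndex (conjSubgroup (x ^ n * v) V) = V.relIndex (conjSubgroup x V) ^ n := by
    simpa using hpow 1
  rw [scale_eq_of_relIndex_pow hVc hVo (hV.relIndex_conjSubgroup_pow hh),
    scale_eq_of_relIndex_pow hVc hVo (fun k => by rw [hpow, h1]), h1]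

/-! ### Contraction subgroups -/

lemma mem_contractionSubgroup {x g : G} : g ∈ contractionSubgroup x ↔
    Tendsto (fun n : ℕ => x ^ n * g * (x ^ n)⁻¹) atTop (𝓝 1) := Iff.rfl

lemma contractionSubgroup_conj (t x : G) :
    contractionSubgroup (t * x * t⁻¹) = conjSubgroup t (contractionSubgroup x) := by
  have key : ∀ t x g : G, g ∈ contractionSubgroup x →
      t * g * t⁻¹ ∈ contractionSubgroup (t * x * t⁻¹) := by
    intro t x g hg
    rw [mem_contractionSubgroup] at hg ⊢
    have hc : Continuous fun a : G => t * a * t⁻¹ := by fun_prop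
    convert (hc.tendsto' 1 1 (by simp)).comp hg using 2 with n
    simp only [conj_pow, Function.comp_apply]
    group
  ext g
  rw [mem_conjSubgroup]
  refine ⟨fun h => ?_, fun h => ?_⟩
  · simpa [mul_assoc] using key t⁻¹ _ g h
  · simpa [mul_assoc] using key t x _ h

lemma contractionSubgroup_pow (x : G) {n : ℕ} (hn : n ≠ 0) :
    contractionSubgroup (x ^ n) = contractionSubgroup x := by
  ext g
  simp only [mem_contractionSubgroup]
  refine ⟨fun h => ?_, fun h => ?_⟩
  · rw [tendsto_def]
    intro U hU
    have hr : ∀ᶠ q : ℕ in atTop, ∀ r ∈ Finset.range n,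
        x ^ r * ((x ^ n) ^ q * g * ((x ^ n) ^ q)⁻¹) * (x ^ r)⁻¹ ∈ U := by
      refine (Filter.eventually_all_finset _).2 fun r _ => ?_
      have hc : Continuous fun a : G => x ^ r * a * (x ^ r)⁻¹ := by fun_prop
      exact ((hc.tendsto' 1 1 (by simp)).comp h).eventually hU
    filter_upwards [(Nat.tendsto_div_const_atTop hn).eventually hr] with m hm
    have := hm (m % n) (Finset.mem_range.2 (Nat.mod_lt _ (Nat.pos_of_ne_zero hn)))
    have e : x ^ m = x ^ (m % n) * (x ^ n) ^ (m / n) := by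
      rw [← pow_mul, ← pow_add, Nat.mod_add_div]
    rw [Set.mem_preimage, e]
    simpa [mul_assoc] using this
  · convert h.comp (tendsto_id.const_mul_atTop' (Nat.pos_of_ne_zero hn)) using 2 with k
    simp [pow_mul]

/-- Conjugating a sequence that tends to `1` by elements of a compact set does not affect
convergence to `1`. -/
lemma tendsto_conj_of_isCompact {K : Set G} (hK : IsCompact K) {f k : ℕ → G}
    (hf : Tendsto f atTop (𝓝 1)) (hk : ∀ n, k n ∈ K) :
    Tendsto (fun n => k n * f n * (k n)⁻¹) atTop (𝓝 1) := by
  rw [tendsto_def]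
  intro U hU
  have : ∀ᶠ g : G in 𝓝 1, ∀ c ∈ K, c * g * c⁻¹ ∈ U := by
    refine hK.eventually_forall_of_forall_eventually fun c _ => ?_
    have hc : Continuous fun p : G × G => p.2 * p.1 * p.2⁻¹ := by fun_prop
    exact (hc.tendsto' ((1 : G), c) 1 (by simp)).eventually hU
  filter_upwards [hf.eventually this] with n hn
  exact hn _ (hk n)

/-- The orbits of `x v` and `x` stay uniformly close after translation by a suitable `t ∈ V`. Finite
stages are obtained by successive corrections from `V₊`, and compactness gives `t`. -/
lemma TidyAbove.exists_forall_mul_pow_mul_mem (hV : TidyAbove x V) (hVc : IsCompact (V : Set G))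
    (hVo : IsOpen (V : Set G)) {v : G} (hv : v ∈ V) :
    ∃ t ∈ V, ∀ k : ℕ, (x * v) ^ k * t * (x ^ k)⁻¹ ∈ V := by
  have key : ∀ n : ℕ, ∃ t ∈ V, ∀ k ≤ n, (x * v) ^ k * t * (x ^ k)⁻¹ ∈ V := by
    intro n
    induction n with
    | zero => exact ⟨1, one_mem _, fun k hk => by simp [Nat.le_zero.1 hk]⟩
    | succ n ih =>
      obtain ⟨t, ht, h⟩ := ih
      obtain ⟨a, ha, b, hb, hab⟩ := hV _ (mul_mem hv (h n le_rfl))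
      have hb' : ∀ k : ℕ, conjPow x (-k) b⁻¹ ∈ V := fun k =>
        mem_plusPart.1 (inv_mem hb) _ (by omega)
      refine ⟨t * conjPow x (-n) b⁻¹, mul_mem ht (hb' n), fun k hk => ?_⟩
      rcases Nat.le_succ_iff.1 hk with hk | rfl
      · have e : (x * v) ^ k * (t * conjPow x (-n) b⁻¹) * (x ^ k)⁻¹ =
            ((x * v) ^ k * t * (x ^ k)⁻¹) * conjPow x (-(n - k : ℕ)) b⁻¹ := by
          have : (-(n - k : ℕ) : ℤ) = k + -n := by omega
          rw [this, ← conjPow_conjPow, ← conj_pow_eq_conjPow x _ k]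
          group
        rw [e]
        exact mul_mem (h k hk) (hb' _)
      · have e : (x * v) ^ (n + 1) * (t * conjPow x (-n) b⁻¹) * (x ^ (n + 1))⁻¹ =
            conjPow x 1 a := by
          have h1 : (x * v) ^ n * t = v⁻¹ * (a * b) * x ^ n := by
            rw [← hab]; group
          rw [pow_succ', mul_assoc (x * v), ← mul_assoc _ t, h1, ← inv_conj_pow_eq_conjPow,
            pow_succ', conjPow_apply]
          group
        rw [e]
        exact mem_minusPart.1 ha 1 zero_le_one
  have hVcl := V.isClosed_of_isOpen hVo
  have hcl : ∀ n : ℕ, IsClosed {t | t ∈ V ∧ ∀ k ≤ n, (x * v) ^ k * t * (x ^ k)⁻¹ ∈ V} := fun n => by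
    have : {t | t ∈ V ∧ ∀ k ≤ n, (x * v) ^ k * t * (x ^ k)⁻¹ ∈ V} = (V : Set G) ∩
        ⋂ k ≤ n, (fun t => (x * v) ^ k * t * (x ^ k)⁻¹) ⁻¹' (V : Set G) := by ext; simp
    rw [this]
    exact hVcl.inter (isClosed_biInter fun k _ => hVcl.preimage (by fun_prop))
  obtain ⟨t, ht⟩ := IsCompact.nonempty_iInter_of_sequence_nonempty_isCompact_isClosed
    (fun n : ℕ => {t | t ∈ V ∧ ∀ k ≤ n, (x * v) ^ k * t * (x ^ k)⁻¹ ∈ V})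
    (fun n t ht => ⟨ht.1, fun k hk => ht.2 k (by omega)⟩) key
    (hVc.of_isClosed_subset (hcl 0) fun t ht => ht.1) hcl
  rw [Set.mem_iInter] at ht
  exact ⟨t, (ht 0).1, fun k => (ht k).2 k le_rfl⟩

theorem TidyAbove.exists_contractionSubgroup_mul_eq (hV : TidyAbove x V)
    (hVc : IsCompact (V : Set G)) (hVo : IsOpen (V : Set G)) {v : G} (hv : v ∈ V) :
    ∃ t : G, contractionSubgroup (x * v) = conjSubgroup t (contractionSubgroup x) := by
  obtain ⟨t, -, ht⟩ := hV.exists_forall_mul_pow_mul_mem hVc hVo hv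
  refine ⟨t, ?_⟩
  ext g
  rw [mem_conjSubgroup, mem_contractionSubgroup, mem_contractionSubgroup]
  refine ⟨fun h => ?_, fun h => ?_⟩
  · convert tendsto_conj_of_isCompact hVc h (fun n => inv_mem (ht n)) using 2 with n
    group
  · convert tendsto_conj_of_isCompact hVc h ht using 2 with n
    group

/-! ### Recurrence on a quotient of finite volume -/

/-- Poincaré recurrence for the translation by `x` on `G ⧸ H` and the image of the open
subgroup `V`. -/
lemma HasFiniteCovolume.exists_pow_mul_mem {H : Subgroup G} (hH : HasFiniteCovolume H)
    (hVo : IsOpen (V : Set G)) (x : G) :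
    ∃ n : ℕ, n ≠ 0 ∧ ∃ v ∈ V, ∃ w ∈ V, w⁻¹ * (x ^ n * v) ∈ H := by
  let _ : MeasurableSpace (G ⧸ H) := borel (G ⧸ H)
  have _ : BorelSpace (G ⧸ H) := ⟨rfl⟩
  obtain ⟨μ, hμ, _, _, _⟩ := hH
  have hO : IsOpen ((QuotientGroup.mk : G → G ⧸ H) '' (V : Set G)) :=
    QuotientGroup.isOpenMap_coe _ hVo
  have hpos := measure_isOpen_pos_of_smulInvariant_of_ne_zero G hμ hO ⟨_, 1, one_mem V, rfl⟩
  obtain ⟨_, ⟨v, hv, rfl⟩, n, hn, w, hw, hwv⟩ := (measurePreserving_smul x μ).exists_mem_iterate_mem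
    hO.measurableSet.nullMeasurableSet hpos.ne'
  rw [smul_iterate_apply, MulAction.Quotient.smul_mk] at hwv
  exact ⟨n, hn, v, hv, w, hw, QuotientGroup.eq.1 hwv⟩

end Index

theorem theorem2p4 {G : Type*} [Group G] [TopologicalSpace G] [IsTopologicalGroup G]
    [LocallyCompactSpace G] [TotallyDisconnectedSpace G]
    (H : Subgroup G) (hH : IsClosed (H : Set G)) (hcov : HasFiniteCovolume H) (x : G) :
    ∃ n : ℕ, 1 ≤ n ∧ ∃ h : G, h ∈ H ∧
      scale x ^ n = scale h ∧
      ∃ g : G, contractionSubgroup h = conjSubgroup g (contractionSubgroup x) := by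
  obtain ⟨V, hVc, hVo, hV, hh⟩ := exists_tidy x
  obtain ⟨n, hn, v, hv, w, hw, hmem⟩ := hcov.exists_pow_mul_mem hVo x
  -- `h = w⁻¹ (xⁿ v)` is conjugate to the element `xⁿ (v w⁻¹)` of `xⁿ V`
  have e : w⁻¹ * (x ^ n * v) = w⁻¹ * (x ^ n * (v * w⁻¹)) * w⁻¹⁻¹ := by group
  have hvw : v * w⁻¹ ∈ V := mul_mem hv (inv_mem hw)
  obtain ⟨t, ht⟩ := (hV.pow n).exists_contractionSubgroup_mul_eq hVc hVo hvw
  refine ⟨n, Nat.one_le_iff_ne_zero.2 hn, _, hmem, ?_, w⁻¹ * t, ?_⟩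
  · rw [e, scale_conj, hV.scale_pow_mul hh hVc hVo n hvw]
  · rw [e, contractionSubgroup_conj, ht, contractionSubgroup_pow x hn, conjSubgroup_mul]
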